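/- An affine Chvátal function $f:\mathbb R^n\to\mathbb R$ is a function given by a finite binary tree whose leaves are affine linear functions $x\mapsto c^\top x+e$ with $c\in\mathbb Q^n$, $e\in\mathbb Q$, and in which every other node either has one child, with function $g$, and represents $\lceil g\rceil$ or $\alpha g$ for some $\alpha\in\mathbb Q_+$, or has two children, with functions $g,h$, and represents $\alpha g+\beta h$ for some $\alpha,\beta\in\mathbb Q_+$; $f$ is the function represented by the root. A set $S\subseteq\mathbb R^{N}$ is a disjunctive mixed-integer Chvátal (DMIC) set if there are $n,q\ge 0$ with $n+q=N$, affine Chvátal functions $f_{ij}:\mathbb R^{N}\to\mathbb R$ and numbers $b_{ij}\in\mathbb R$ ($i=1,\dots,m$, $j=1,\dots,t$) such that $$S=\bigcup_{j=1}^t\{(x,z)\in\mathbb R^n\times\mathbb Z^q: f_{ij}(x,z)\le b_{ij}\text{ for } i=1,\dots,m\}.$$ A set $S\subseteq\mathbb R^n$ is MILP-representable if there are rational matrices $A,B,C$ and a rational vector $d$ such that $S=\{x\in\mathbb R^n:\ \exists\, y\in\mathbb R^p,\ z\in\mathbb Z^q,\ Ax+By+Cz\ge d\}$. **Statement.** The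 set $$E=\{(\lambda,2\lambda):\lambda\in\mathbb Z_+\}\cup\{(2\lambda,\lambda):\lambda\in\mathbb Z_+\}\subseteq\mathbb R^2$$ is a DMIC set but is not MILP-representable. The class of DMIC sets (in all dimensions) is strictly larger than the class of MILP-representable sets: every MILP-representable set is a DMIC set, and some DMIC set is not MILP-representable. -/

import Mathlib

/-- Finite binary trees encoding affine Chvátal functions of `n` real variables. Leaves carry affine
linear functions `x ↦ ∑ cᵢ xᵢ + e` with rational coefficients; a node has either one child, whose
edge is labelled by the ceiling or by a nonnegative rational, or two children, whose edges are both
labelled by nonnegative rationals. -/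
inductive ChvatalTree (n : ℕ) : Type where
  | leaf (c : Fin n → ℚ) (e : ℚ) : ChvatalTree n
  | ceil (g : ChvatalTree n) : ChvatalTree n
  | scale (a : NNRat) (g : ChvatalTree n) : ChvatalTree n
  | comb (a : NNRat) (g : ChvatalTree n) (b : NNRat) (h : ChvatalTree n) : ChvatalTree n

/-- The function `ℝⁿ → ℝ` built from a tree. -/
noncomputable def ChvatalTree.eval {n : ℕ} : ChvatalTree n → (Fin n → ℝ) → ℝ
  | .leaf c e, x => (∑ i, (c i : ℝ) * x i) + (e : ℝ)
  | .ceil g, x => ((⌈g.eval x⌉ : ℤ) : ℝ)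
  | .scale a g, x => (a : ℝ) * g.eval x
  | .comb a g b h, x => (a : ℝ) * g.eval x + (b : ℝ) * h.eval x

/-- `f : ℝⁿ → ℝ` is an affine Chvátal function if it is built from some tree. -/
def IsAffineChvatal {n : ℕ} (f : (Fin n → ℝ) → ℝ) : Prop :=
  ∃ T : ChvatalTree n, T.eval = f

/-- `ℝⁿ × ℤ^q` inside `ℝ^N`, where `N = n + q`: the coordinates with index at least `n`
(counted from `0`) are integers, the first `n` are arbitrary reals. -/
def mixedIntegerSpace (N n : ℕ) : Set (Fin N → ℝ) :=
  {w | ∀ i : Fin N, n ≤ (i : ℕ) → ∃ k : ℤ, w i = (k : ℝ)}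

/-- `S ⊆ ℝ^N` is a disjunctive mixed-integer Chvátal (DMIC) set: for some splitting `N = n + q` it is
the union over `j = 1, …, t` of the sets of `(x, z) ∈ ℝⁿ × ℤ^q` satisfying the affine Chvátal
inequalities `f_{ij}(x, z) ≤ b_{ij}`, `i = 1, …, m`. -/
def IsDMIC {N : ℕ} (S : Set (Fin N → ℝ)) : Prop :=
  ∃ n q : ℕ, n + q = N ∧
    ∃ (m t : ℕ) (f : Fin m → Fin t → (Fin N → ℝ) → ℝ) (b : Fin m → Fin t → ℝ),
      (∀ i j, IsAffineChvatal (f i j)) ∧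
      S = ⋃ j : Fin t, {w | w ∈ mixedIntegerSpace N n ∧ ∀ i : Fin m, f i j w ≤ b i j}

/-- `S ⊆ ℝⁿ` is MILP-representable: it is the projection to the `x`-coordinates of
`{(x, y, z) ∈ ℝⁿ × ℝᵖ × ℤ^q : A x + B y + C z ≥ d}` for rational matrices `A`, `B`, `C` and a
rational vector `d`. -/
def IsMILPRepresentable {n : ℕ} (S : Set (Fin n → ℝ)) : Prop :=
  ∃ (m p q : ℕ) (A : Matrix (Fin m) (Fin n) ℚ) (B : Matrix (Fin m) (Fin p) ℚ)
    (C : Matrix (Fin m) (Fin q) ℚ) (d : Fin m → ℚ),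
    S = {x | ∃ (y : Fin p → ℝ) (z : Fin q → ℤ), ∀ i : Fin m,
      (A.map (Rat.cast : ℚ → ℝ)).mulVec x i + (B.map (Rat.cast : ℚ → ℝ)).mulVec y i
        + (C.map (Rat.cast : ℚ → ℝ)).mulVec (fun k => (z k : ℝ)) i ≥ (d i : ℝ)}

/-- `{(l, 2l) : l ∈ ℤ₊} ∪ {(2l, l) : l ∈ ℤ₊}` as a subset of the plane. -/
def twoRays : Set (Fin 2 → ℝ) :=
  {w | ∃ l : ℕ, w = ![(l : ℝ), 2 * (l : ℝ)]} ∪ {w | ∃ l : ℕ, w = ![2 * (l : ℝ), (l : ℝ)]}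

/-- The class of all MILP-representable sets, in all dimensions. -/
def milpClass : Set (Σ n : ℕ, Set (Fin n → ℝ)) :=
  {P | IsMILPRepresentable P.2}

/-- The class of all DMIC sets, in all dimensions. -/
def dmicClass : Set (Σ n : ℕ, Set (Fin n → ℝ)) :=
  {P | IsDMIC P.2}

/-!
A set that is MILP-representable is a projection of a rational polyhedron along real and integer
variables. The real variables are removed by Fourier–Motzkin elimination
(`IsMILPRepresentable.exists_ratPolyhedron`), while all constraints are still affine. Each integer
variable is then removed from finite unions of Chvátal systems
(`IsChvatalDisjunction.exists_append_int`). The point is that an affine Chvátal function `f` is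
quasi-periodic in every variable: `f (x, z + D w) = f (x, z) + k w` for some `D > 0` and rational
`k`, and all integers `w` (`ChvatalTree.exists_hasPeriod`). Writing `z = r + D w` with
`0 ≤ r < D` for a common period `D`, one gets, for each of the finitely many residues `r`, a system
that is affine in `w`. An integer `w` between the lower bounds `a i` and the upper bounds `- b j`
exists if and only if `⌈a i⌉ + b j ≤ 0` for all `i`, `j`, and these are again Chvátal inequalities.

The set `twoRays` is a union of two sets of integer points of rational polyhedra, hence a DMIC set.
If it were MILP-representable, it would be the projection along integer variables of a rational
polyhedron `P`. The points of either ray lift to integer points of `P`, whose vectors of slacks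
have bounded denominators. By Dickson's lemma two of the points on each ray have comparable slacks,
so their difference is a recession direction of `P`
(`IsRatPolyhedron.exists_lt_forall_add_sub_mem`). Starting from the origin and adding one such
direction from each ray yields a point off both rays.
-/

/-! ### Simultaneous lower and upper bounds -/

theorem exists_between_of_finite {α ι κ : Type*} [LinearOrder α] [Nonempty α] [Finite ι] [Finite κ]
    (a : ι → α) (b : κ → α) (h : ∀ i j, a i ≤ b j) : ∃ w, (∀ i, a i ≤ w) ∧ ∀ j, w ≤ b j := by
  rcases isEmpty_or_nonempty ι with hι | hι
  · rcases isEmpty_or_nonempty κ with hκ | hκ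
    · exact ⟨Classical.arbitrary α, fun i => hι.elim i, fun j => hκ.elim j⟩
    · obtain ⟨j, hj⟩ := Finite.exists_min b
      exact ⟨b j, fun i => h i j, hj⟩
  · obtain ⟨i, hi⟩ := Finite.exists_max a
    exact ⟨a i, hi, h i⟩

/-- One step of Fourier–Motzkin elimination over `ℝ`. -/
theorem exists_real_forall_add_mul_nonpos_iff {ι : Type*} [Finite ι] (a k : ι → ℝ) :
    (∃ w : ℝ, ∀ i, a i + k i * w ≤ 0) ↔
      (∀ i, k i = 0 → a i ≤ 0) ∧
        ∀ i j, k i < 0 → 0 < k j → (-k i)⁻¹ * a i + (k j)⁻¹ * a j ≤ 0 := by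
  have hneg : ∀ i (w : ℝ), k i < 0 → (a i + k i * w ≤ 0 ↔ (-k i)⁻¹ * a i ≤ w) := by
    intro i w hi
    rw [inv_mul_le_iff₀ (by linarith)]
    constructor <;> intro h <;> linarith
  have hpos : ∀ i (w : ℝ), 0 < k i → (a i + k i * w ≤ 0 ↔ w ≤ -((k i)⁻¹ * a i)) := by
    intro i w hi
    rw [← mul_neg, le_inv_mul_iff₀ hi]
    constructor <;> intro h <;> linarith
  constructor
  · rintro ⟨w, hw⟩
    refine ⟨fun i hi => by simpa [hi] using hw i, fun i j hi hj => ?_⟩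
    have h1 := (hneg i w hi).1 (hw i)
    have h2 := (hpos j w hj).1 (hw j)
    linarith
  · rintro ⟨h0, h1⟩
    obtain ⟨w, hl, hu⟩ := exists_between_of_finite
      (fun i : {i // k i < 0} => (-k i)⁻¹ * a i) (fun j : {j // 0 < k j} => -((k j)⁻¹ * a j))
      (fun i j => by have := h1 i j i.2 j.2; linarith)
    refine ⟨w, fun i => ?_⟩
    rcases lt_trichotomy (k i) 0 with hi | hi | hi
    · exact (hneg i w hi).2 (hl ⟨i, hi⟩)
    · simpa [hi] using h0 i hi
    · exact (hpos i w hi).2 (hu ⟨i, hi⟩)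

/-- The integer analogue of a Fourier–Motzkin step: an integer lies above `a` exactly when it lies
above `⌈a⌉`, so rounding up the lower bounds suffices. -/
theorem exists_int_forall_add_mul_nonpos_iff {ι : Type*} [Finite ι] (a k : ι → ℝ) :
    (∃ w : ℤ, ∀ i, a i + k i * w ≤ 0) ↔
      (∀ i, k i = 0 → a i ≤ 0) ∧
        ∀ i j, k i < 0 → 0 < k j → (⌈(-k i)⁻¹ * a i⌉ : ℝ) + (k j)⁻¹ * a j ≤ 0 := by
  have hneg : ∀ i (w : ℤ), k i < 0 → (a i + k i * w ≤ 0 ↔ ⌈(-k i)⁻¹ * a i⌉ ≤ w) := by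
    intro i w hi
    rw [Int.ceil_le, inv_mul_le_iff₀ (by linarith)]
    constructor <;> intro h <;> linarith
  have hpos : ∀ i (w : ℤ), 0 < k i → (a i + k i * w ≤ 0 ↔ (w : ℝ) ≤ -((k i)⁻¹ * a i)) := by
    intro i w hi
    rw [← mul_neg, le_inv_mul_iff₀ hi]
    constructor <;> intro h <;> linarith
  constructor
  · rintro ⟨w, hw⟩
    refine ⟨fun i hi => by simpa [hi] using hw i, fun i j hi hj => ?_⟩
    have h1 : (⌈(-k i)⁻¹ * a i⌉ : ℝ) ≤ w := by exact_mod_cast (hneg i w hi).1 (hw i)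
    have h2 := (hpos j w hj).1 (hw j)
    linarith
  · rintro ⟨h0, h1⟩
    obtain ⟨w, hl, hu⟩ := exists_between_of_finite
      (fun i : {i // k i < 0} => ⌈(-k i)⁻¹ * a i⌉) (fun j : {j // 0 < k j} => ⌊-((k j)⁻¹ * a j)⌋)
      (fun i j => by rw [Int.le_floor]; have := h1 i j i.2 j.2; linarith)
    refine ⟨w, fun i => ?_⟩
    rcases lt_trichotomy (k i) 0 with hi | hi | hi
    · exact (hneg i w hi).2 (hl ⟨i, hi⟩)
    · simpa [hi] using h0 i hi
    · exact (hpos i w hi).2 (Int.le_floor.1 (hu ⟨i, hi⟩))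

/-! ### Projections of rational polyhedra -/

/-- The value at `x` of the affine function with coefficients `c` and constant term `e`. -/
noncomputable def ratAffine {n : ℕ} (c : Fin n → ℚ) (e : ℚ) (x : Fin n → ℝ) : ℝ :=
  (∑ i, (c i : ℝ) * x i) + (e : ℝ)

theorem ratAffine_snoc {n : ℕ} (c : Fin (n + 1) → ℚ) (e : ℚ) (x : Fin n → ℝ) (y : ℝ) :
    ratAffine c e (Fin.snoc x y) =
      ratAffine (fun i => c i.castSucc) e x + (c (Fin.last n) : ℝ) * y := by
  simp only [ratAffine, Fin.sum_univ_castSucc, Fin.snoc_castSucc, Fin.snoc_last]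
  ring

theorem ratAffine_combination {n : ℕ} (c c' : Fin n → ℚ) (e e' a b : ℚ) (x : Fin n → ℝ) :
    ratAffine (fun i => a * c i + b * c' i) (a * e + b * e') x =
      (a : ℝ) * ratAffine c e x + (b : ℝ) * ratAffine c' e' x := by
  simp only [ratAffine, mul_add, Finset.mul_sum, Rat.cast_add, Rat.cast_mul, add_mul,
    Finset.sum_add_distrib, mul_assoc]
  ring

/-- The solution sets of finitely many affine inequalities with rational data. -/
def IsRatPolyhedron {n : ℕ} (S : Set (Fin n → ℝ)) : Prop :=
  ∃ (ι : Type) (_ : Finite ι) (c : ι → Fin n → ℚ) (e : ι → ℚ),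
    S = {x | ∀ i, ratAffine (c i) (e i) x ≤ 0}

theorem IsRatPolyhedron.exists_snoc {n : ℕ} {S : Set (Fin (n + 1) → ℝ)} (hS : IsRatPolyhedron S) :
    IsRatPolyhedron {x : Fin n → ℝ | ∃ y : ℝ, Fin.snoc (α := fun _ => ℝ) x y ∈ S} := by
  obtain ⟨ι, _, c, e, rfl⟩ := hS
  let k : ι → ℚ := fun i => c i (Fin.last n)
  refine ⟨{i // k i = 0} ⊕ {i // k i < 0} × {i // 0 < k i}, inferInstance,
    Sum.elim (fun i j => c i j.castSucc)
      (fun p j => (-k p.1)⁻¹ * c p.1 j.castSucc + (k p.2)⁻¹ * c p.2 j.castSucc),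
    Sum.elim (fun i => e i) (fun p => (-k p.1)⁻¹ * e p.1 + (k p.2)⁻¹ * e p.2), ?_⟩
  ext x
  have := exists_real_forall_add_mul_nonpos_iff
    (fun i => ratAffine (fun j => c i j.castSucc) (e i) x) (fun i => (k i : ℝ))
  simp only [Set.mem_ofPred_eq, ratAffine_snoc, Sum.forall, Sum.elim_inl, Sum.elim_inr,
    ratAffine_combination, Subtype.forall, Prod.forall]
  refine this.trans ?_
  simp only [Rat.cast_eq_zero, Rat.cast_lt_zero, Rat.cast_pos, Rat.cast_inv, Rat.cast_neg]
  exact and_congr Iff.rfl ⟨fun h i hi j hj => h i j hi hj, fun h i j hi hj => h i hi j hj⟩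

theorem append_fin_zero {α : Type*} {n : ℕ} (x : Fin n → α) (y : Fin 0 → α) :
    Fin.append x y = x := by
  rw [Subsingleton.elim y Fin.elim0, Fin.append_elim0]
  rfl

theorem IsRatPolyhedron.exists_append {n p : ℕ} {S : Set (Fin (n + p) → ℝ)}
    (hS : IsRatPolyhedron S) :
    IsRatPolyhedron {x : Fin n → ℝ | ∃ y : Fin p → ℝ, Fin.append x y ∈ S} := by
  induction p with
  | zero =>
    have key : {x : Fin n → ℝ | ∃ y : Fin 0 → ℝ, Fin.append x y ∈ S} = S :=
      Set.ext fun x => ⟨fun ⟨y, hy⟩ => by rwa [append_fin_zero] at hy,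
        fun h => ⟨Fin.elim0, by rwa [append_fin_zero]⟩⟩
    rw [key]
    exact hS
  | succ p ih =>
    convert ih (IsRatPolyhedron.exists_snoc (n := n + p) hS) using 1
    ext x
    constructor
    · rintro ⟨y, hy⟩
      refine ⟨Fin.init y, y (Fin.last p), ?_⟩
      rwa [← Fin.append_snoc, Fin.snoc_init_self]
    · rintro ⟨y, a, hy⟩
      exact ⟨Fin.snoc y a, by rwa [Fin.append_snoc]⟩

/-- Eliminating the real auxiliary variables presents an MILP-representable set as the
projection, along integer variables only, of a rational polyhedron. -/
theorem IsMILPRepresentable.exists_ratPolyhedron {n : ℕ} {S : Set (Fin n → ℝ)}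
    (hS : IsMILPRepresentable S) :
    ∃ (q : ℕ) (P : Set (Fin (n + q) → ℝ)), IsRatPolyhedron P ∧
      S = {x | ∃ z : Fin q → ℤ, Fin.append x (fun k => (z k : ℝ)) ∈ P} := by
  obtain ⟨m, p, q, A, B, C, d, rfl⟩ := hS
  refine ⟨q, _, IsRatPolyhedron.exists_append (p := p) ⟨Fin m, inferInstance,
    fun i => Fin.append (Fin.append (fun j => -A i j) (fun j => -C i j)) (fun j => -B i j),
    d, rfl⟩, ?_⟩
  ext x
  simp only [Set.mem_ofPred_eq]
  rw [exists_comm]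
  refine exists_congr fun z => exists_congr fun y => forall_congr' fun i => ?_
  simp only [ratAffine, Fin.sum_univ_add, Fin.append_left, Fin.append_right, Matrix.mulVec,
    dotProduct, Matrix.map_apply, Rat.cast_neg, neg_mul, Finset.sum_neg_distrib]
  constructor <;> intro h <;> linarith

/-! ### Chvátal systems and elimination of integer variables -/

/-- The solution sets of finitely many affine Chvátal inequalities `f ≤ 0`. -/
def IsChvatalSystem {n : ℕ} (S : Set (Fin n → ℝ)) : Prop :=
  ∃ (ι : Type) (_ : Finite ι) (T : ι → ChvatalTree n), S = {x | ∀ i, (T i).eval x ≤ 0}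

/-- The finite unions of solution sets of Chvátal systems. -/
def IsChvatalDisjunction {n : ℕ} (S : Set (Fin n → ℝ)) : Prop :=
  ∃ (ι : Type) (_ : Finite ι) (P : ι → Set (Fin n → ℝ)),
    (∀ i, IsChvatalSystem (P i)) ∧ S = ⋃ i, P i

theorem IsRatPolyhedron.isChvatalSystem {n : ℕ} {S : Set (Fin n → ℝ)} (hS : IsRatPolyhedron S) :
    IsChvatalSystem S := by
  obtain ⟨ι, hι, c, e, rfl⟩ := hS
  exact ⟨ι, hι, fun i => .leaf (c i) (e i), rfl⟩

theorem IsChvatalSystem.isChvatalDisjunction {n : ℕ} {S : Set (Fin n → ℝ)}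
    (hS : IsChvatalSystem S) : IsChvatalDisjunction S :=
  ⟨Unit, inferInstance, fun _ => S, fun _ => hS, (Set.iUnion_const S).symm⟩

theorem IsChvatalDisjunction.iUnion {n : ℕ} {ι : Type} [Finite ι] {S : ι → Set (Fin n → ℝ)}
    (hS : ∀ i, IsChvatalDisjunction (S i)) : IsChvatalDisjunction (⋃ i, S i) := by
  choose κ hκ P hP hSP using hS
  refine ⟨Σ i, κ i, inferInstance, fun s => P s.1 s.2, fun s => hP s.1 s.2, ?_⟩
  rw [Set.iUnion_sigma]
  exact Set.iUnion_congr hSP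

theorem ChvatalTree.exists_eval_snoc {n : ℕ} (T : ChvatalTree (n + 1)) (r : ℚ) :
    ∃ U : ChvatalTree n, ∀ x : Fin n → ℝ, U.eval x = T.eval (Fin.snoc x (r : ℝ)) := by
  induction T with
  | leaf c e =>
    refine ⟨.leaf (fun i => c i.castSucc) (e + c (Fin.last n) * r), fun x => ?_⟩
    simp only [eval, Fin.sum_univ_castSucc, Fin.snoc_castSucc, Fin.snoc_last, Rat.cast_add,
      Rat.cast_mul]
    ring
  | ceil g ih =>
    obtain ⟨U, hU⟩ := ih
    exact ⟨.ceil U, fun x => by simp only [eval, hU]⟩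
  | scale a g ih =>
    obtain ⟨U, hU⟩ := ih
    exact ⟨.scale a U, fun x => by simp only [eval, hU]⟩
  | comb a g b h ihg ihh =>
    obtain ⟨U, hU⟩ := ihg
    obtain ⟨V, hV⟩ := ihh
    exact ⟨.comb a U b V, fun x => by simp only [eval, hU, hV]⟩

/-- `T` is quasi-periodic in its last variable, with period `D` and increment `k`. -/
def ChvatalTree.HasPeriod {n : ℕ} (T : ChvatalTree (n + 1)) (D : ℕ) (k : ℚ) : Prop :=
  ∀ (x : Fin n → ℝ) (z : ℝ) (w : ℤ),
    T.eval (Fin.snoc x (z + D * w)) = T.eval (Fin.snoc x z) + k * w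

theorem ChvatalTree.HasPeriod.mul {n : ℕ} {T : ChvatalTree (n + 1)} {D : ℕ} {k : ℚ}
    (h : T.HasPeriod D k) (m : ℕ) : T.HasPeriod (D * m) (k * m) := by
  intro x z w
  have := h x z (m * w)
  push_cast at this ⊢
  rw [mul_assoc, this, mul_assoc]

/-- A multiple of the period makes the increment an integer, which then passes through the
ceiling; hence every Chvátal tree is quasi-periodic. -/
theorem ChvatalTree.exists_hasPeriod {n : ℕ} (T : ChvatalTree (n + 1)) :
    ∃ D : ℕ, 0 < D ∧ ∃ k : ℚ, T.HasPeriod D k := by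
  induction T with
  | leaf c e =>
    refine ⟨1, one_pos, c (Fin.last n), fun x z w => ?_⟩
    simp only [eval, Fin.sum_univ_castSucc, Fin.snoc_castSucc, Fin.snoc_last]
    push_cast
    ring
  | ceil g ih =>
    obtain ⟨D, hD, k, hk⟩ := ih
    refine ⟨D * k.den, Nat.mul_pos hD k.den_pos, k * k.den, fun x z w => ?_⟩
    have hnum : ((k * k.den : ℚ) : ℝ) * w = ((k.num * w : ℤ) : ℝ) := by
      rw [Rat.mul_den_eq_num]; push_cast; rfl
    rw [eval, eval, hk.mul k.den x z w, hnum, Int.ceil_add_intCast]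
    push_cast
    rfl
  | scale a g ih =>
    obtain ⟨D, hD, k, hk⟩ := ih
    refine ⟨D, hD, a * k, fun x z w => ?_⟩
    simp only [eval, hk x z w]
    push_cast
    ring
  | comb a g b h ihg ihh =>
    obtain ⟨D, hD, k, hk⟩ := ihg
    obtain ⟨D', hD', k', hk'⟩ := ihh
    refine ⟨D * D', Nat.mul_pos hD hD', a * (k * D') + b * (k' * D), fun x z w => ?_⟩
    have h2 := hk'.mul D
    rw [mul_comm D' D] at h2
    simp only [eval, hk.mul D' x z w, h2 x z w]
    push_cast
    ring

theorem isChvatalSystem_exists_int {n : ℕ} {ι : Type} [Finite ι] (U : ι → ChvatalTree n)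
    (k : ι → ℚ) :
    IsChvatalSystem {x : Fin n → ℝ | ∃ w : ℤ, ∀ i, (U i).eval x + (k i : ℝ) * w ≤ 0} := by
  have hcast : ∀ a : ℚ, 0 ≤ a → ((a.toNNRat : NNRat) : ℝ) = (a : ℝ) := fun a ha => by
    exact_mod_cast congrArg (Rat.cast : ℚ → ℝ) (Rat.coe_toNNRat a ha)
  refine ⟨{i // k i = 0} ⊕ {i // k i < 0} × {i // 0 < k i}, inferInstance,
    Sum.elim (fun i => U i) (fun p => .comb 1 (.ceil (.scale (-k p.1)⁻¹.toNNRat (U p.1)))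
      (k p.2)⁻¹.toNNRat (U p.2)), ?_⟩
  ext x
  have := exists_int_forall_add_mul_nonpos_iff (fun i => (U i).eval x) (fun i => (k i : ℝ))
  refine this.trans ?_
  simp only [Set.mem_ofPred_eq, Sum.forall, Sum.elim_inl, Sum.elim_inr, Subtype.forall, Prod.forall,
    Rat.cast_eq_zero, Rat.cast_lt_zero, Rat.cast_pos, ChvatalTree.eval]
  refine and_congr Iff.rfl ⟨fun h i hi j hj => ?_, fun h i j hi hj => ?_⟩
  · have := h i j hi hj
    rw [hcast _ (inv_nonneg.2 (by linarith)), hcast _ (inv_nonneg.2 hj.le)]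
    simpa using this
  · have := h i hi j hj
    rw [hcast _ (inv_nonneg.2 (by linarith)), hcast _ (inv_nonneg.2 hj.le)] at this
    simpa using this

/-- Splitting the integer variable by its residue modulo a common period makes every constraint
affine in the quotient, which is then eliminated. -/
theorem IsChvatalSystem.exists_snoc_int {n : ℕ} {S : Set (Fin (n + 1) → ℝ)}
    (hS : IsChvatalSystem S) :
    IsChvatalDisjunction {x : Fin n → ℝ | ∃ z : ℤ, Fin.snoc (α := fun _ => ℝ) x (z : ℝ) ∈ S} := by
  obtain ⟨ι, _, T, rfl⟩ := hS
  have := Fintype.ofFinite ι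
  choose D hD k hk using fun i => (T i).exists_hasPeriod
  obtain ⟨M, hM, hdvd⟩ : ∃ M : ℕ, 0 < M ∧ ∀ i, D i ∣ M :=
    ⟨∏ i, D i, Finset.prod_pos fun i _ => hD i, fun i => Finset.dvd_prod_of_mem D (by simp)⟩
  choose m hm using hdvd
  have hper : ∀ i, (T i).HasPeriod M (k i * m i) := fun i => by
    have := (hk i).mul (m i)
    rwa [← hm i] at this
  choose U hU using fun (r : Fin M) i => (T i).exists_eval_snoc (r : ℚ)
  have key : {x : Fin n → ℝ | ∃ z : ℤ, Fin.snoc (α := fun _ => ℝ) x (z : ℝ) ∈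
      {x | ∀ i, (T i).eval x ≤ 0}} =
      ⋃ r : Fin M, {x | ∃ w : ℤ, ∀ i, (U r i).eval x + ((k i * m i : ℚ) : ℝ) * w ≤ 0} := by
    ext x
    simp only [Set.mem_ofPred_eq, Set.mem_iUnion]
    have hstep : ∀ (r : Fin M) (w : ℤ) i, (U r i).eval x + ((k i * m i : ℚ) : ℝ) * w =
        (T i).eval (Fin.snoc x (((r : ℤ) + M * w : ℤ) : ℝ)) := by
      intro r w i
      rw [hU, ← hper i x _ w]
      push_cast
      rfl
    constructor
    · rintro ⟨z, hz⟩
      have hM' : (0 : ℤ) < M := by exact_mod_cast hM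
      have h0 := Int.emod_nonneg z hM'.ne'
      have h1 := Int.emod_lt_of_pos z hM'
      refine ⟨⟨(z % M).toNat, by omega⟩, z / M, fun i => ?_⟩
      rw [hstep]
      simp only [Int.toNat_of_nonneg h0, Int.emod_add_mul_ediv]
      exact hz i
    · rintro ⟨r, w, h⟩
      exact ⟨r + M * w, fun i => by rw [← hstep]; exact h i⟩
  rw [key]
  exact .iUnion fun r => (isChvatalSystem_exists_int _ _).isChvatalDisjunction

theorem IsChvatalDisjunction.exists_snoc_int {n : ℕ} {S : Set (Fin (n + 1) → ℝ)}
    (hS : IsChvatalDisjunction S) :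
    IsChvatalDisjunction {x : Fin n → ℝ | ∃ z : ℤ, Fin.snoc (α := fun _ => ℝ) x (z : ℝ) ∈ S} := by
  obtain ⟨ι, _, P, hP, rfl⟩ := hS
  convert IsChvatalDisjunction.iUnion fun i => (hP i).exists_snoc_int using 1
  ext x
  simp only [Set.mem_ofPred_eq, Set.mem_iUnion]
  exact exists_comm

theorem IsChvatalDisjunction.exists_append_int {n q : ℕ} {S : Set (Fin (n + q) → ℝ)}
    (hS : IsChvatalDisjunction S) :
    IsChvatalDisjunction
      {x : Fin n → ℝ | ∃ z : Fin q → ℤ, Fin.append x (fun k => (z k : ℝ)) ∈ S} := by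
  induction q with
  | zero =>
    have key : {x : Fin n → ℝ | ∃ z : Fin 0 → ℤ, Fin.append x (fun k => (z k : ℝ)) ∈ S} = S :=
      Set.ext fun x => ⟨fun ⟨y, hy⟩ => by rwa [append_fin_zero] at hy,
        fun h => ⟨Fin.elim0, by rwa [append_fin_zero]⟩⟩
    rw [key]
    exact hS
  | succ q ih =>
    convert ih (IsChvatalDisjunction.exists_snoc_int (n := n + q) hS) using 1
    ext x
    have hcast : ∀ (z : Fin q → ℤ) (a : ℤ),
        (fun i => ((Fin.snoc (α := fun _ => ℤ) z a i : ℤ) : ℝ)) =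
          Fin.snoc (α := fun _ => ℝ) (fun i => (z i : ℝ)) (a : ℝ) := by
      intro z a
      ext i
      refine Fin.lastCases ?_ (fun i => ?_) i <;> simp
    constructor
    · rintro ⟨z, hz⟩
      refine ⟨Fin.init z, z (Fin.last q), ?_⟩
      rwa [← Fin.append_snoc, ← hcast, Fin.snoc_init_self]
    · rintro ⟨z, a, hz⟩
      exact ⟨Fin.snoc z a, by rwa [hcast, Fin.append_snoc]⟩

/-- Constraints of the disjuncts other than the `j`-th one are replaced in the `j`-th column by
the trivial constraint `0 ≤ 0`, so that all disjuncts have the same number of constraints. -/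
theorem IsChvatalDisjunction.isDMIC_inter {n q : ℕ} {S : Set (Fin (n + q) → ℝ)}
    (hS : IsChvatalDisjunction S) : IsDMIC (mixedIntegerSpace (n + q) n ∩ S) := by
  classical
  obtain ⟨ι, _, P, hP, rfl⟩ := hS
  choose κ hκ T hT using hP
  let σ := Finite.equivFin (Σ i, κ i)
  let τ := Finite.equivFin ι
  let V : (Σ i, κ i) → ι → ChvatalTree (n + q) :=
    fun s i => if s.1 = i then T s.1 s.2 else .leaf 0 0
  refine ⟨n, q, rfl, _, _, fun s j => (V (σ.symm s) (τ.symm j)).eval, fun _ _ => 0,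
    fun _ _ => ⟨_, rfl⟩, ?_⟩
  have hV : ∀ i w, (∀ s, (V s i).eval w ≤ 0) ↔ w ∈ P i := by
    intro i w
    rw [hT]
    constructor
    · intro h a
      simpa [V] using h ⟨i, a⟩
    · rintro h ⟨i', a⟩
      by_cases hi : i' = i
      · subst hi
        simpa [V] using h a
      · simp [V, hi, ChvatalTree.eval]
  ext w
  simp only [Set.mem_inter_iff, Set.mem_iUnion, Set.mem_ofPred_eq, exists_and_left]
  refine and_congr Iff.rfl ?_
  rw [τ.symm.exists_congr_left]
  refine exists_congr fun i => ?_
  rw [← hV, ← σ.symm.forall_congr_right]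
  simp

theorem IsMILPRepresentable.isDMIC {n : ℕ} {S : Set (Fin n → ℝ)} (hS : IsMILPRepresentable S) :
    IsDMIC S := by
  obtain ⟨q, P, hP, rfl⟩ := hS.exists_ratPolyhedron
  have h := IsChvatalDisjunction.isDMIC_inter (n := n) (q := 0)
    hP.isChvatalSystem.isChvatalDisjunction.exists_append_int
  have huniv : mixedIntegerSpace (n + 0) n = Set.univ :=
    Set.eq_univ_of_forall fun w i hi => absurd i.2 (by omega)
  rwa [huniv, Set.univ_inter] at h

/-! ### The two rays -/

theorem isDMIC_twoRays : IsDMIC twoRays := by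
  -- `false` is the ray of slope `2`, `true` the ray of slope `1 / 2`
  let c : Bool → Fin 3 → Fin 2 → ℚ := fun s =>
    if s then ![![0, -1], ![1, -2], ![-1, 2]] else ![![-1, 0], ![-2, 1], ![2, -1]]
  have hD : IsChvatalDisjunction (⋃ s : Bool, {x : Fin 2 → ℝ | ∀ i, ratAffine (c s i) 0 x ≤ 0}) :=
    .iUnion fun s => IsChvatalSystem.isChvatalDisjunction <|
      IsRatPolyhedron.isChvatalSystem ⟨Fin 3, inferInstance, c s, fun _ => 0, rfl⟩
  convert IsChvatalDisjunction.isDMIC_inter (n := 0) (q := 2) hD using 1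
  ext w
  simp only [twoRays, mixedIntegerSpace, Set.mem_union, Set.mem_ofPred_eq, Set.mem_inter_iff,
    Set.mem_iUnion, Bool.exists_bool, ratAffine, Fin.sum_univ_two, Fin.forall_fin_succ, c]
  simp
  constructor
  · rintro (⟨l, rfl⟩ | ⟨l, rfl⟩)
    · exact ⟨⟨⟨l, by simp⟩, ⟨2 * l, by simp⟩⟩, .inl (by simp)⟩
    · exact ⟨⟨⟨2 * l, by simp⟩, ⟨l, by simp⟩⟩, .inr (by simp)⟩
  · rintro ⟨⟨⟨a, ha⟩, ⟨b, hb⟩⟩, h | h⟩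
    · left
      have h0 : 0 ≤ a := by
        have : (0 : ℝ) ≤ a := by rw [← ha]; linarith
        exact_mod_cast this
      lift a to ℕ using h0
      refine ⟨a, ?_⟩
      ext i
      fin_cases i
      · simpa using ha
      · simp at ha ⊢; linarith
    · right
      have h0 : 0 ≤ b := by
        have : (0 : ℝ) ≤ b := by rw [← hb]; linarith
        exact_mod_cast this
      lift b to ℕ using h0
      refine ⟨b, ?_⟩
      ext i
      fin_cases i
      · simp at hb ⊢; linarith
      · simpa using hb

theorem exists_mul_ratAffine_int {N : ℕ} (c : Fin N → ℚ) (e : ℚ) :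
    ∃ D : ℕ, 0 < D ∧ ∀ u : Fin N → ℤ, ∃ k : ℤ,
      (D : ℝ) * ratAffine c e (fun i => (u i : ℝ)) = k := by
  obtain ⟨D, hD, hc⟩ : ∃ D : ℕ, 0 < D ∧ ∀ i, (c i).den ∣ D :=
    ⟨∏ i, (c i).den, Finset.prod_pos fun i _ => (c i).den_pos,
      fun i => Finset.dvd_prod_of_mem (fun i => (c i).den) (Finset.mem_univ i)⟩
  choose m hm using hc
  refine ⟨D * e.den, Nat.mul_pos hD e.den_pos, fun u =>
    ⟨(∑ i, e.den * (m i * (c i).num) * u i) + D * e.num, ?_⟩⟩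
  have hnum : ∀ a : ℚ, (a : ℝ) * a.den = a.num := fun a => by exact_mod_cast Rat.mul_den_eq_num a
  simp only [ratAffine]
  push_cast
  rw [mul_add, Finset.mul_sum]
  congr 1
  · refine Finset.sum_congr rfl fun i _ => ?_
    rw [← hnum, hm i]
    push_cast
    ring
  · rw [← hnum]
    ring

/-- On integer points the slacks of a rational polyhedron take values in a discrete set, so by
Dickson's lemma some point of an infinite sequence dominates an earlier one in all slacks; their
difference is a recession direction. -/
theorem IsRatPolyhedron.exists_lt_forall_add_sub_mem {N : ℕ} {P : Set (Fin N → ℝ)}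
    (hP : IsRatPolyhedron P) (u : ℕ → Fin N → ℤ) (hu : ∀ l, (fun i => (u l i : ℝ)) ∈ P) :
    ∃ a b, a < b ∧ ∀ x ∈ P, x + (fun i => (u b i : ℝ) - u a i) ∈ P := by
  obtain ⟨ι, _, c, e, rfl⟩ := hP
  choose D hD k hk using fun i => exists_mul_ratAffine_int (c i) (e i)
  have hD' : ∀ i, (0 : ℝ) < D i := fun i => by exact_mod_cast hD i
  have hk0 : ∀ l i, k i (u l) ≤ 0 := by
    intro l i
    have : (k i (u l) : ℝ) ≤ 0 := by
      rw [← hk]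
      exact mul_nonpos_of_nonneg_of_nonpos (hD' i).le (hu l i)
    exact_mod_cast this
  obtain ⟨a, b, hab, hle⟩ := wellQuasiOrdered_le (fun l i => (-k i (u l)).toNat)
  refine ⟨a, b, hab, fun x hx i => ?_⟩
  have hmono : ratAffine (c i) (e i) (fun j => (u b j : ℝ)) ≤
      ratAffine (c i) (e i) (fun j => (u a j : ℝ)) := by
    have h1 : k i (u b) ≤ k i (u a) := by
      have h2 := hle i
      have h3 := hk0 a i
      have h4 := hk0 b i
      simp only at h2
      omega
    refine le_of_mul_le_mul_left ?_ (hD' i)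
    rw [hk, hk]
    exact_mod_cast h1
  have hx := hx i
  simp only [ratAffine, Pi.add_apply, mul_add, mul_sub, Finset.sum_add_distrib,
    Finset.sum_sub_distrib] at hmono hx ⊢
  linarith

/-- An integer sequence inside a set of the shape of `IsMILPRepresentable.exists_ratPolyhedron`
lifts to the polyhedron, which gains a recession direction over a difference of its terms. -/
theorem IsRatPolyhedron.exists_recession_append {n q : ℕ} {P : Set (Fin (n + q) → ℝ)}
    (hP : IsRatPolyhedron P) (x : ℕ → Fin n → ℤ)
    (hx : ∀ l, ∃ z : Fin q → ℤ, Fin.append (fun i => (x l i : ℝ)) (fun k => (z k : ℝ)) ∈ P) :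
    ∃ a b, a < b ∧ ∀ (y : Fin n → ℝ), (∃ z : Fin q → ℤ, Fin.append y (fun k => (z k : ℝ)) ∈ P) →
      ∃ z : Fin q → ℤ, Fin.append (y + fun i => (x b i : ℝ) - x a i) (fun k => (z k : ℝ)) ∈ P := by
  choose z hz using hx
  have hcast : ∀ l, (fun i => ((Fin.append (x l) (z l) i : ℤ) : ℝ)) =
      Fin.append (fun i => (x l i : ℝ)) (fun k => (z l k : ℝ)) := fun l => by
    ext i
    refine Fin.addCases (fun i => ?_) (fun i => ?_) i <;> simp
  obtain ⟨a, b, hab, h⟩ := hP.exists_lt_forall_add_sub_mem (fun l => Fin.append (x l) (z l))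
    (fun l => by rw [hcast]; exact hz l)
  refine ⟨a, b, hab, fun y ⟨t, ht⟩ => ⟨fun k => t k + (z b k - z a k), ?_⟩⟩
  convert h _ ht using 1
  ext i
  refine Fin.addCases (fun i => ?_) (fun i => ?_) i <;> simp

theorem not_isMILPRepresentable_twoRays : ¬ IsMILPRepresentable twoRays := by
  intro h
  obtain ⟨q, P, hP, hE⟩ := h.exists_ratPolyhedron
  have hmem : ∀ w, w ∈ twoRays ↔ ∃ z : Fin q → ℤ, Fin.append w (fun k => (z k : ℝ)) ∈ P := by
    intro w
    rw [hE, Set.mem_ofPred_eq]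
  have hrec := hP.exists_recession_append
  simp only [← hmem] at hrec
  obtain ⟨a, b, hab, h1⟩ := hrec (fun l => ![l, 2 * l]) fun l => .inl ⟨l, by
    ext i; fin_cases i <;> simp⟩
  obtain ⟨a', b', hab', h2⟩ := hrec (fun l => ![2 * l, l]) fun l => .inr ⟨l, by
    ext i; fin_cases i <;> simp⟩
  -- the point reached is `(s + 2 t, 2 s + t)` with `s = b - a > 0` and `t = b' - a' > 0`
  have h3 := h2 _ (h1 0 (.inl ⟨0, by ext i; fin_cases i <;> simp⟩))
  have hab : (a : ℝ) < b := by exact_mod_cast hab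
  have hab' : (a' : ℝ) < b' := by exact_mod_cast hab'
  rcases h3 with ⟨l, hl⟩ | ⟨l, hl⟩
  all_goals
    have e0 := congrFun hl 0
    have e1 := congrFun hl 1
    simp at e0 e1
    linarith

theorem mainTheorem9 :
    IsDMIC twoRays ∧ ¬ IsMILPRepresentable twoRays ∧ milpClass ⊂ dmicClass :=
  ⟨isDMIC_twoRays, not_isMILPRepresentable_twoRays, fun _ h => IsMILPRepresentable.isDMIC h,
    fun h => not_isMILPRepresentable_twoRays (@h ⟨2, twoRays⟩ isDMIC_twoRays)⟩
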